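/- Let $d$ be a non-zero integer that is not divisible by the fourth power of any prime, and let $E^d/\mathbb{Q}$ be the elliptic curve $y^2 = x^3 + dx$. Let $\mathbb{Q}(E^d[8])$ be its $8$-division field, i.e. the subfield of $\overline{\mathbb{Q}}$ generated over $\mathbb{Q}$ by the coordinates of all affine points $P \in E^d(\overline{\mathbb{Q}})$ with $8P = O$. Then: (1) $[\mathbb{Q}(E^d[8]):\mathbb{Q}] = 16$ if and only if $d \in \{\pm 1, \pm 2, \pm 4, \pm 8\}$. (2) $[\mathbb{Q}(E^d[8]):\mathbb{Q}] = 32$ if and only if $d = \pm t^2$ or $d = \pm 2t^2$ for some square-free integer $t \notin \{\pm 1, \pm 2\}$. (3) $[\mathbb{Q}(E^d[8]):\mathbb{Q}] = 64$ in all remaining cases, i.e. if $d \notin \{\pm 1, \pm 2, \pm 4, \pm 8\}$ and $d$ is not of the form $\pm t^2$ or $\pm 2t^2$ with $t$ a square-free integer, $t \notin \{\pm 1, \pm 2\}$. -/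

import Mathlib

/-- The Weierstrass curve `E^d : y ^ 2 = x ^ 3 + d * x` over `ℚ`. -/
def curveE (d : ℤ) : WeierstrassCurve ℚ where
  a₁ := 0
  a₂ := 0
  a₃ := 0
  a₄ := d
  a₆ := 0

open scoped Classical in
/-- The `n`-division field `K(W[n])` of a Weierstrass curve `W` over a field `K`: the subfield of an
algebraic closure of `K` generated over `K` by the coordinates of all affine points `P` of `W` over
the algebraic closure with `n • P = 0`. -/
noncomputable def divisionField {K : Type*} [Field K] (W : WeierstrassCurve K) (n : ℕ) :
    IntermediateField K (AlgebraicClosure K) :=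
  IntermediateField.adjoin K
    {z : AlgebraicClosure K |
      ∃ (x y : AlgebraicClosure K) (h : (W.baseChange (AlgebraicClosure K)).toAffine.Nonsingular x y),
        n • WeierstrassCurve.Affine.Point.some x y h = 0 ∧ (z = x ∨ z = y)}

/-- An integer is fourth-power-free if no fourth power of a prime number divides it. -/
def FourthPowerFree (d : ℤ) : Prop :=
  ∀ p : ℕ, p.Prime → ¬ ((p : ℤ) ^ 4 ∣ d)

/-! Let `δ ^ 4 = d`, `i ^ 2 = -1`, `w ^ 4 = 2`, `u ^ 2 = 1 + i`. The 8-division field is K(δ) with K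
= ℚ(i, w, u), and everything reduces to locating δ relative to K.

Over an algebraic closure the curve is `y² = x(x - s)(x + s)` with `s = iδ²`. A point `(x, y)` is
halved by extracting square roots a, b, c of `x`, `x - s`, `x + s`: with `y = abc`, one half is
`((a+b)(a+c), (a+b)(a+c)(b+c))` (`two_nsmul_some`), and a, b, c are rational functions of it
(`half_parameters_eq`). So the 8-torsion generates exactly the square roots attached to the
4-torsion points, and these generate K(δ) (`mem_of_eight_torsion_subset`,
`mem_of_eight_nsmul_eq_zero`).

K has degree 16, by a tower of four quadratic steps (`finrank_towerField`). Since `i ∈ K`, if `δ² ∉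
K` then K(δ) has degree 4 over K (`notMem_sup_adjoin_simple_of_sq_eq_mul`); hence the degree is 16,
32 or 64 according to whether δ, only δ², or neither lies in K. The only rational numbers with a
square root in K are those in ±1, ±2 times squares. Applied to δ² this gives the forms ±t², ±2t²
(`sq_mem_towerField_iff`); applied twice, with fourth-power-freeness, it gives the eight exceptional
d (`mem_towerField_iff`). -/

open IntermediateField

/-! ### Square roots in quadratic extensions. -/

section QuadraticTower

variable {k Ω : Type*} [Field k] [Field Ω] [Algebra k Ω]

theorem finrank_sup_adjoin_simple_of_mem {F : IntermediateField k Ω} {α : Ω} (h : α ∈ F) :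
    Module.finrank k ↥(F ⊔ k⟮α⟯) = Module.finrank k F := by
  rw [sup_eq_left.2 (adjoin_simple_le_iff.2 h)]

variable [Algebra.IsAlgebraic k Ω]

/-- Algebraicity turns the compositum into a generated algebra, so inverses need no treatment; the
elements `a + b * α` are closed under products because `α ^ 2 ∈ F`. -/
theorem exists_add_mul_of_mem_sup_adjoin_simple {F : IntermediateField k Ω} {α x : Ω}
    (hα : α ^ 2 ∈ F) (hx : x ∈ F ⊔ k⟮α⟯) : ∃ a ∈ F, ∃ b ∈ F, x = a + b * α := by
  rw [← mem_toSubalgebra, sup_toSubalgebra_of_isAlgebraic_left,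
    adjoin_simple_toSubalgebra_of_isAlgebraic (Algebra.IsAlgebraic.isAlgebraic α)] at hx
  have hx' : x ∈ Algebra.adjoin k ((F : Set Ω) ∪ {α}) := by
    rw [Algebra.adjoin_union]
    have hF : F.toSubalgebra ≤ Algebra.adjoin k (F : Set Ω) :=
      fun y hy => Algebra.subset_adjoin hy
    exact sup_le_sup_right hF _ hx
  clear hx
  induction hx' using Algebra.adjoin_induction with
  | mem y hy =>
    rcases hy with hy | rfl
    · exact ⟨y, hy, 0, F.zero_mem, by simp⟩
    · exact ⟨0, F.zero_mem, 1, F.one_mem, by simp⟩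
  | algebraMap r => exact ⟨_, F.algebraMap_mem r, 0, F.zero_mem, by simp⟩
  | add y z hy hz ihy ihz =>
    obtain ⟨a, ha, b, hb, rfl⟩ := ihy
    obtain ⟨c, hc, e, he, rfl⟩ := ihz
    exact ⟨a + c, F.add_mem ha hc, b + e, F.add_mem hb he, by ring⟩
  | mul y z hy hz ihy ihz =>
    obtain ⟨a, ha, b, hb, rfl⟩ := ihy
    obtain ⟨c, hc, e, he, rfl⟩ := ihz
    exact ⟨a * c + b * e * α ^ 2, F.add_mem (F.mul_mem ha hc) (F.mul_mem (F.mul_mem hb he) hα),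
      a * e + b * c, F.add_mem (F.mul_mem ha he) (F.mul_mem hb hc), by ring⟩

/-- For `α ∉ F`, the cross term `2abα` of `(a + bα)²` must vanish, so `a = 0` or `b = 0`. -/
theorem mem_or_mul_mem_of_sq_mem [NeZero (2 : Ω)] {F : IntermediateField k Ω} {α β : Ω}
    (hα : α ^ 2 ∈ F) (hβ : β ^ 2 ∈ F) (h : β ∈ F ⊔ k⟮α⟯) : β ∈ F ∨ β * α ∈ F := by
  obtain ⟨a, ha, b, hb, rfl⟩ := exists_add_mul_of_mem_sup_adjoin_simple hα h
  by_cases hαF : α ∈ F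
  · exact Or.inl (F.add_mem ha (F.mul_mem hb hαF))
  have h2 : (2 : Ω) ∈ F := ofNat_mem F 2
  have key : a * b = 0 := by
    by_contra hab
    apply hαF
    have : α = ((a + b * α) ^ 2 - a ^ 2 - b ^ 2 * α ^ 2) / (2 * (a * b)) := by
      have h2' : (2 : Ω) ≠ 0 := NeZero.ne 2
      rw [eq_div_iff (mul_ne_zero h2' hab)]
      ring
    rw [this]
    exact F.div_mem (F.sub_mem (F.sub_mem hβ (pow_mem ha 2)) (F.mul_mem (pow_mem hb 2) hα))
      (F.mul_mem h2 (F.mul_mem ha hb))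
  rcases mul_eq_zero.1 key with rfl | rfl
  · right
    have : (0 + b * α) * α = b * α ^ 2 := by ring
    rw [this]
    exact F.mul_mem hb hα
  · left
    simpa using ha

/-- If `(a + bα)² = cα`, then `a² + b²α² = 0`, which factors as `(a - ibα)(a + ibα)` because `i ∈
F`; since `2ab = c ≠ 0`, this puts α in F. -/
theorem notMem_sup_adjoin_simple_of_sq_eq_mul [NeZero (2 : Ω)] {F : IntermediateField k Ω}
    {i α β c : Ω} (hi : i ^ 2 = -1) (hiF : i ∈ F) (hα : α ^ 2 ∈ F) (hαF : α ∉ F) (hc : c ∈ F)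
    (hc0 : c ≠ 0) (hβ : β ^ 2 = c * α) : β ∉ F ⊔ k⟮α⟯ := by
  intro h
  obtain ⟨a, ha, b, hb, rfl⟩ := exists_add_mul_of_mem_sup_adjoin_simple hα h
  have h2 : (2 : Ω) ∈ F := ofNat_mem F 2
  have hlin : c = 2 * a * b := by
    by_contra hne
    apply hαF
    have : α = (a ^ 2 + b ^ 2 * α ^ 2) / (c - 2 * a * b) := by
      rw [eq_div_iff (sub_ne_zero.2 hne)]
      linear_combination -hβ
    rw [this]
    exact F.div_mem (F.add_mem (pow_mem ha 2) (F.mul_mem (pow_mem hb 2) hα))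
      (F.sub_mem hc (F.mul_mem (F.mul_mem h2 ha) hb))
  have hb0 : b ≠ 0 := by
    rintro rfl
    exact hc0 (by simpa using hlin)
  have hprod : (a - i * b * α) * (a + i * b * α) = 0 := by
    linear_combination hβ + α * hlin - b ^ 2 * α ^ 2 * hi
  have hi0 : i ≠ 0 := by
    rintro rfl
    simp at hi
  have hib : i * b ≠ 0 := mul_ne_zero hi0 hb0
  rcases mul_eq_zero.1 hprod with h0 | h0
  · apply hαF
    have : α = a / (i * b) := by
      rw [eq_div_iff hib]
      linear_combination -h0
    rw [this]
    exact F.div_mem ha (F.mul_mem hiF hb)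
  · apply hαF
    have : α = -a / (i * b) := by
      rw [eq_div_iff hib]
      linear_combination h0
    rw [this]
    exact F.div_mem (F.neg_mem ha) (F.mul_mem hiF hb)

theorem finrank_sup_adjoin_simple_of_notMem {F : IntermediateField k Ω} {α : Ω}
    (hα : α ^ 2 ∈ F) (h : α ∉ F) :
    Module.finrank k ↥(F ⊔ k⟮α⟯) = Module.finrank k F * 2 := by
  have hint : IsIntegral F α := ⟨Polynomial.X ^ 2 - Polynomial.C ⟨α ^ 2, hα⟩,
    Polynomial.monic_X_pow_sub_C _ two_ne_zero, by simp⟩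
  have hle : Module.finrank F F⟮α⟯ ≤ 2 := by
    rw [adjoin.finrank hint]
    refine (Polynomial.natDegree_le_of_dvd (minpoly.dvd F α
      (p := Polynomial.X ^ 2 - Polynomial.C ⟨α ^ 2, hα⟩) (by simp))
      (Polynomial.monic_X_pow_sub_C _ two_ne_zero).ne_zero).trans ?_
    rw [Polynomial.natDegree_X_pow_sub_C]
  have h1 : Module.finrank F F⟮α⟯ ≠ 1 := by
    rw [Ne, IntermediateField.finrank_eq_one_iff, adjoin_simple_eq_bot_iff, mem_bot]
    rintro ⟨y, rfl⟩
    exact h y.2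
  have : FiniteDimensional F F⟮α⟯ := adjoin.finiteDimensional hint
  have h0 : 0 < Module.finrank F F⟮α⟯ := Module.finrank_pos
  have h2 : Module.finrank F F⟮α⟯ = 2 := by omega
  rw [← restrictScalars_adjoin_eq_sup, ← h2]
  exact (Module.finrank_mul_finrank k F F⟮α⟯).symm

end QuadraticTower

/-! ### Square roots in ℚ(i). -/

section RationalSquares

variable {Ω : Type*} [Field Ω] [Algebra ℚ Ω] [Algebra.IsAlgebraic ℚ Ω]

/-- The norm of `c(1 + i)` to ℚ is `2c²`, which is not a rational square. -/
theorem notMem_adjoin_of_sq_eq_mul_one_add [CharZero Ω] {i β : Ω} (hi : i ^ 2 = -1) {c : ℚ}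
    (hc : c ≠ 0) (hβ : β ^ 2 = algebraMap ℚ Ω c * (1 + i)) :
    β ∉ (⊥ : IntermediateField ℚ Ω) ⊔ ℚ⟮i⟯ := by
  intro h
  obtain ⟨a, ha, b, hb, rfl⟩ := exists_add_mul_of_mem_sup_adjoin_simple
    (by rw [hi]; exact neg_mem (one_mem _)) h
  obtain ⟨a, rfl⟩ := mem_bot.1 ha
  obtain ⟨b, rfl⟩ := mem_bot.1 hb
  have hiQ : ∀ q : ℚ, algebraMap ℚ Ω q ≠ i := by
    rintro q rfl
    have : q ^ 2 = -1 := by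
      apply (algebraMap ℚ Ω).injective
      simpa using hi
    nlinarith
  have h1 : c = 2 * a * b := by
    by_contra hne
    apply hiQ ((a ^ 2 - b ^ 2 - c) / (c - 2 * a * b))
    have : c - 2 * a * b ≠ 0 := sub_ne_zero.2 hne
    have h0 : algebraMap ℚ Ω (c - 2 * a * b) ≠ 0 :=
      (map_ne_zero _).2 this
    rw [map_div₀, div_eq_iff h0]
    simp only [map_sub, map_mul, map_pow, map_ofNat]
    linear_combination hβ - (algebraMap ℚ Ω b) ^ 2 * hi
  have h2 : a ^ 2 - b ^ 2 = c := by
    apply (algebraMap ℚ Ω).injective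
    have h1' := congrArg (algebraMap ℚ Ω) h1
    simp only [map_sub, map_mul, map_pow, map_ofNat] at h1' ⊢
    linear_combination hβ - (algebraMap ℚ Ω b) ^ 2 * hi + i * h1'
  have h3 : (a ^ 2 + b ^ 2) ^ 2 = 2 * c ^ 2 := by
    linear_combination (a ^ 2 - b ^ 2 + c) * h2 - (c + 2 * a * b) * h1
  have h4 : IsSquare (2 : ℚ) := ⟨(a ^ 2 + b ^ 2) / c, by field_simp; linarith⟩
  rw [show (2 : ℚ) = ((2 : ℕ) : ℚ) by norm_num, Rat.isSquare_natCast_iff] at h4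
  exact Nat.prime_two.not_isSquare h4

theorem exists_rat_of_sq_mem_of_mem_adjoin [CharZero Ω] {i β : Ω} (hi : i ^ 2 = -1) {c : ℚ}
    (hβ : β ^ 2 = algebraMap ℚ Ω c) (h : β ∈ (⊥ : IntermediateField ℚ Ω) ⊔ ℚ⟮i⟯) :
    ∃ q : ℚ, β = algebraMap ℚ Ω q ∨ β * i = algebraMap ℚ Ω q := by
  rcases mem_or_mul_mem_of_sq_mem (by rw [hi]; exact neg_mem (one_mem _))
    (by rw [hβ]; exact _root_.algebraMap_mem _ c) h with h | h
  · obtain ⟨q, hq⟩ := mem_bot.1 h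
    exact ⟨q, Or.inl hq.symm⟩
  · obtain ⟨q, hq⟩ := mem_bot.1 h
    exact ⟨q, Or.inr hq.symm⟩

end RationalSquares

/-- The field generated over `ℚ` by `i`, `w` and `u`, as a tower of square root extensions. It is
used with `i` a square root of `-1`, `w` a fourth root of `2` and `u` a square root of `1 + i`. -/
def towerField {Ω : Type*} [Field Ω] [Algebra ℚ Ω] (i w u : Ω) : IntermediateField ℚ Ω :=
  (⊥ : IntermediateField ℚ Ω) ⊔ ℚ⟮i⟯ ⊔ ℚ⟮w ^ 2⟯ ⊔ ℚ⟮w⟯ ⊔ ℚ⟮u⟯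

/-! ### The degree-16 field ℚ(i, w, u) and the rational numbers that become squares in it. -/

section Tower

variable {Ω : Type*} [Field Ω] [Algebra ℚ Ω] {i w u : Ω}

theorem towerField_le_iff {F : IntermediateField ℚ Ω} :
    towerField i w u ≤ F ↔ i ∈ F ∧ w ∈ F ∧ u ∈ F := by
  simp only [towerField, sup_le_iff, adjoin_simple_le_iff, bot_le, true_and]
  exact ⟨fun ⟨⟨⟨a, b⟩, c⟩, e⟩ => ⟨a, c, e⟩, fun ⟨a, c, e⟩ => ⟨⟨⟨a, pow_mem c 2⟩, c⟩, e⟩⟩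

theorem left_mem_towerField : i ∈ towerField i w u := (towerField_le_iff.1 le_rfl).1

theorem middle_mem_towerField : w ∈ towerField i w u := (towerField_le_iff.1 le_rfl).2.1

variable [CharZero Ω] [Algebra.IsAlgebraic ℚ Ω]

theorem sq_notMem_adjoin (hi : i ^ 2 = -1) (hw : w ^ 4 = 2) :
    w ^ 2 ∉ (⊥ : IntermediateField ℚ Ω) ⊔ ℚ⟮i⟯ := by
  intro h
  obtain ⟨q, hq⟩ := exists_rat_of_sq_mem_of_mem_adjoin (c := 2) hi
    (by rw [map_ofNat, ← hw]; ring) h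
  have hinj := (algebraMap ℚ Ω).injective
  rcases hq with hq | hq
  · have h2 : q * q = 2 := by
      apply hinj
      rw [map_mul, ← hq, map_ofNat, ← hw]
      ring
    have h4 : IsSquare (2 : ℚ) := ⟨q, h2.symm⟩
    rw [show (2 : ℚ) = ((2 : ℕ) : ℚ) by norm_num, Rat.isSquare_natCast_iff] at h4
    exact Nat.prime_two.not_isSquare h4
  · have h2 : q * q = -2 := by
      apply hinj
      rw [map_mul, ← hq, map_neg, map_ofNat]
      linear_combination w ^ 4 * hi - hw
    nlinarith [mul_self_nonneg q]

theorem notMem_sup_adjoin_sq (hi : i ^ 2 = -1) (hw : w ^ 4 = 2) :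
    w ∉ (⊥ : IntermediateField ℚ Ω) ⊔ ℚ⟮i⟯ ⊔ ℚ⟮w ^ 2⟯ := by
  refine notMem_sup_adjoin_simple_of_sq_eq_mul (c := 1) hi ?_ ?_ (sq_notMem_adjoin hi hw)
    (one_mem _) one_ne_zero (by ring)
  · exact (le_sup_right : ℚ⟮i⟯ ≤ _) (mem_adjoin_simple_self ℚ i)
  · rw [← pow_mul, hw]
    exact ofNat_mem _ 2

/-- An element of the tower below `u` whose square is rational is a rational multiple
of a square root of `1`, `-1`, `2` or `-2`. -/
theorem exists_rat_of_sq_mem_of_mem (hi : i ^ 2 = -1) (hw : w ^ 4 = 2) {D : Ω} {d : ℚ} (hd : d ≠ 0)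
    (hD : D ^ 2 = algebraMap ℚ Ω d)
    (h : D ∈ (⊥ : IntermediateField ℚ Ω) ⊔ ℚ⟮i⟯ ⊔ ℚ⟮w ^ 2⟯ ⊔ ℚ⟮w⟯) :
    ∃ q : ℚ, D = algebraMap ℚ Ω q ∨ D * i = algebraMap ℚ Ω q ∨ D * w ^ 2 = algebraMap ℚ Ω q ∨
      D * w ^ 2 * i = algebraMap ℚ Ω q := by
  set K₁ : IntermediateField ℚ Ω := (⊥ : IntermediateField ℚ Ω) ⊔ ℚ⟮i⟯
  have hiK : i ∈ K₁ := (le_sup_right : ℚ⟮i⟯ ≤ _) (mem_adjoin_simple_self ℚ i)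
  have hw4 : (w ^ 2) ^ 2 ∈ K₁ := by
    rw [← pow_mul, hw]
    exact ofNat_mem _ 2
  have hw2 : w ^ 2 ∈ K₁ ⊔ ℚ⟮w ^ 2⟯ := (le_sup_right : ℚ⟮w ^ 2⟯ ≤ _) (mem_adjoin_simple_self ℚ _)
  have hd0 : algebraMap ℚ Ω d ≠ 0 := (map_ne_zero _).2 hd
  rcases mem_or_mul_mem_of_sq_mem hw2 (by rw [hD]; exact _root_.algebraMap_mem _ d) h with h | h
  · rcases mem_or_mul_mem_of_sq_mem hw4 (by rw [hD]; exact _root_.algebraMap_mem _ d) h with h | h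
    · obtain ⟨q, hq⟩ := exists_rat_of_sq_mem_of_mem_adjoin hi hD h
      exact ⟨q, by tauto⟩
    · obtain ⟨q, hq⟩ := exists_rat_of_sq_mem_of_mem_adjoin (c := d * 2) hi
        (by rw [map_mul, map_ofNat, ← hD, ← hw]; ring) h
      exact ⟨q, by tauto⟩
  -- Here `D * w` would lie in ℚ(i, √2), yet its square is `d * w ^ 2`, a multiple of the last
  -- generator.
  · exact absurd h (notMem_sup_adjoin_simple_of_sq_eq_mul hi hiK hw4 (sq_notMem_adjoin hi hw)
      (_root_.algebraMap_mem _ d) hd0 (by rw [← hD]; ring))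

/-- An element whose square is a non-zero rational multiple of `1 + i` is not in the tower
below `u`. -/
theorem notMem_of_sq_eq_mul_one_add (hi : i ^ 2 = -1) (hw : w ^ 4 = 2) {v : Ω} {c : ℚ} (hc : c ≠ 0)
    (hv : v ^ 2 = algebraMap ℚ Ω c * (1 + i)) :
    v ∉ (⊥ : IntermediateField ℚ Ω) ⊔ ℚ⟮i⟯ ⊔ ℚ⟮w ^ 2⟯ ⊔ ℚ⟮w⟯ := by
  intro h
  set K₁ : IntermediateField ℚ Ω := (⊥ : IntermediateField ℚ Ω) ⊔ ℚ⟮i⟯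
  have hiK : i ∈ K₁ := (le_sup_right : ℚ⟮i⟯ ≤ _) (mem_adjoin_simple_self ℚ i)
  have hw4 : (w ^ 2) ^ 2 ∈ K₁ := by
    rw [← pow_mul, hw]
    exact ofNat_mem _ 2
  have hw2 : w ^ 2 ∈ K₁ ⊔ ℚ⟮w ^ 2⟯ := (le_sup_right : ℚ⟮w ^ 2⟯ ≤ _) (mem_adjoin_simple_self ℚ _)
  have hc0 : algebraMap ℚ Ω c ≠ 0 := (map_ne_zero _).2 hc
  have hvK : v ^ 2 ∈ K₁ := by
    rw [hv]
    exact mul_mem (_root_.algebraMap_mem _ c) (add_mem (one_mem _) hiK)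
  have hi1 : 1 + i ≠ 0 := by
    intro h0
    have : (2 : Ω) = 0 := by linear_combination (1 - i) * h0 + hi
    exact two_ne_zero this
  rcases mem_or_mul_mem_of_sq_mem hw2 ((le_sup_left : K₁ ≤ _) hvK) h with h | h
  · rcases mem_or_mul_mem_of_sq_mem hw4 hvK h with h | h
    · exact notMem_adjoin_of_sq_eq_mul_one_add hi hc hv h
    · refine notMem_adjoin_of_sq_eq_mul_one_add (c := c * 2) hi (mul_ne_zero hc two_ne_zero) ?_ h
      rw [map_mul, map_ofNat, ← hw]
      linear_combination w ^ 4 * hv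
  · exact notMem_sup_adjoin_simple_of_sq_eq_mul hi hiK hw4 (sq_notMem_adjoin hi hw) hvK
      (by rw [hv]; exact mul_ne_zero hc0 hi1) (by ring) h

theorem finrank_towerField (hi : i ^ 2 = -1) (hw : w ^ 4 = 2) (hu : u ^ 2 = 1 + i) :
    Module.finrank ℚ (towerField i w u) = 16 := by
  have hiK : i ∈ (⊥ : IntermediateField ℚ Ω) ⊔ ℚ⟮i⟯ :=
    (le_sup_right : ℚ⟮i⟯ ≤ _) (mem_adjoin_simple_self ℚ i)
  have hi1 : i ∉ (⊥ : IntermediateField ℚ Ω) := by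
    rw [mem_bot]
    rintro ⟨q, rfl⟩
    have : q ^ 2 = -1 := by
      apply (algebraMap ℚ Ω).injective
      simpa using hi
    nlinarith
  rw [towerField, finrank_sup_adjoin_simple_of_notMem, finrank_sup_adjoin_simple_of_notMem,
    finrank_sup_adjoin_simple_of_notMem, finrank_sup_adjoin_simple_of_notMem,
    IntermediateField.finrank_bot]
  · rw [hi]
    exact neg_mem (one_mem _)
  · exact hi1
  · rw [← pow_mul, hw]
    exact ofNat_mem _ 2
  · exact sq_notMem_adjoin hi hw
  · exact (le_sup_right : ℚ⟮w ^ 2⟯ ≤ _) (mem_adjoin_simple_self ℚ _)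
  · exact notMem_sup_adjoin_sq hi hw
  · rw [hu]
    exact (le_sup_left.trans le_sup_left : (⊥ : IntermediateField ℚ Ω) ⊔ ℚ⟮i⟯ ≤ _)
      (add_mem (one_mem _) hiK)
  · exact notMem_of_sq_eq_mul_one_add (c := 1) hi hw one_ne_zero (by rw [hu]; simp)

/-- Adjoining u creates no new square roots of rationals: otherwise `D * u`, of square `d(1 + i)`,
would already lie below u. -/
theorem exists_rat_of_sq_mem_of_mem_towerField (hi : i ^ 2 = -1) (hw : w ^ 4 = 2)
    (hu : u ^ 2 = 1 + i) {D : Ω} {d : ℚ} (hd : d ≠ 0) (hD : D ^ 2 = algebraMap ℚ Ω d)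
    (h : D ∈ towerField i w u) :
    ∃ q : ℚ, D = algebraMap ℚ Ω q ∨ D * i = algebraMap ℚ Ω q ∨ D * w ^ 2 = algebraMap ℚ Ω q ∨
      D * w ^ 2 * i = algebraMap ℚ Ω q := by
  have hiK : i ∈ (⊥ : IntermediateField ℚ Ω) ⊔ ℚ⟮i⟯ :=
    (le_sup_right : ℚ⟮i⟯ ≤ _) (mem_adjoin_simple_self ℚ i)
  rcases mem_or_mul_mem_of_sq_mem (by
      rw [hu]
      exact (le_sup_left.trans le_sup_left : (⊥ : IntermediateField ℚ Ω) ⊔ ℚ⟮i⟯ ≤ _)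
        (add_mem (one_mem _) hiK)) (by rw [hD]; exact _root_.algebraMap_mem _ d) h with h | h
  · exact exists_rat_of_sq_mem_of_mem hi hw hd hD h
  · exact absurd h (notMem_of_sq_eq_mul_one_add hi hw hd (by rw [← hD, ← hu]; ring))

end Tower

/-- This is the primitive eighth root of unity `(1 + i)/√2`; it makes -1 a fourth power in the
tower. -/
theorem sq_one_add_div_sq {Ω : Type*} [Field Ω] [CharZero Ω] {i w : Ω} (hi : i ^ 2 = -1)
    (hw : w ^ 4 = 2) : ((1 + i) / w ^ 2) ^ 2 = i := by
  have h0 : w ^ 2 ≠ 0 := by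
    intro h
    have : (2 : Ω) = 0 := by rw [← hw]; linear_combination w ^ 2 * h
    exact two_ne_zero this
  rw [div_pow, div_eq_iff (pow_ne_zero 2 h0)]
  linear_combination hi - i * hw

/-! ### The position of δ relative to the tower. -/

section Radical

variable {Ω : Type*} [Field Ω] [Algebra ℚ Ω] {i w u δ : Ω}

theorem mem_of_sq_eq_sq {F : IntermediateField ℚ Ω} {x y : Ω} (hy : y ∈ F) (h : x ^ 2 = y ^ 2) :
    x ∈ F := by
  rcases sq_eq_sq_iff_eq_or_eq_neg.1 h with rfl | rfl
  · exact hy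
  · exact F.neg_mem hy

theorem mem_of_pow_four_eq {F : IntermediateField ℚ Ω} {x y : Ω} (hi : i ^ 2 = -1) (hiF : i ∈ F)
    (hy : y ∈ F) (h : x ^ 4 = y ^ 4) : x ∈ F := by
  have h' : (x ^ 2 - y ^ 2) * (x ^ 2 - (i * y) ^ 2) = 0 := by
    linear_combination h - (y ^ 2 * x ^ 2 - y ^ 4) * hi
  rcases mul_eq_zero.1 h' with h' | h'
  · exact mem_of_sq_eq_sq hy (sub_eq_zero.1 h')
  · exact mem_of_sq_eq_sq (F.mul_mem hiF hy) (sub_eq_zero.1 h')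

theorem one_add_div_sq_mem {F : IntermediateField ℚ Ω} (hiF : i ∈ F) (hw : w ^ 2 ∈ F) :
    (1 + i) / w ^ 2 ∈ F :=
  F.div_mem (F.add_mem F.one_mem hiF) hw

variable [CharZero Ω]

/-- Each listed d is `(-1)^a 2^b = (z^a w^b)^4` with z an eighth root of unity, and the fourth roots
of d differ by powers of i. -/
theorem mem_towerField_of_pow_four_eq (hi : i ^ 2 = -1) (hw : w ^ 4 = 2) {d : ℤ}
    (hδ : δ ^ 4 = d) (hd : d ∈ ({1, -1, 2, -2, 4, -4, 8, -8} : Set ℤ)) :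
    δ ∈ towerField i w u := by
  have hiF : i ∈ towerField i w u := left_mem_towerField
  have hwF : w ∈ towerField i w u := middle_mem_towerField
  have hzF := one_add_div_sq_mem hiF (pow_mem hwF 2)
  have hz := sq_one_add_div_sq hi hw
  generalize (1 + i) / w ^ 2 = z at hzF hz
  have hz4 : z ^ 4 = -1 := by
    rw [← hi, ← hz]
    ring
  have key : ∀ a b : ℕ, (d : Ω) = (-1) ^ a * 2 ^ b → δ ∈ towerField i w u := by
    intro a b h
    refine mem_of_pow_four_eq (y := z ^ a * w ^ b) hi hiF
      (mul_mem (pow_mem hzF a) (pow_mem hwF b)) ?_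
    rw [hδ, h, ← hz4, ← hw]
    ring
  simp only [Set.mem_insert_iff, Set.mem_singleton_iff] at hd
  rcases hd with rfl | rfl | rfl | rfl | rfl | rfl | rfl | rfl
  · exact key 0 0 (by norm_num)
  · exact key 1 0 (by norm_num)
  · exact key 0 1 (by norm_num)
  · exact key 1 1 (by norm_num)
  · exact key 0 2 (by norm_num)
  · exact key 1 2 (by norm_num)
  · exact key 0 3 (by norm_num)
  · exact key 1 3 (by norm_num)

variable [Algebra.IsAlgebraic ℚ Ω]

/-- The square-root classification is used twice. For δ² it makes `(δη)²` rational with η among 1,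
z, w, wz; for δη it makes `δηε` rational with ε among 1, i, w², iw². Fourth powers then give `c =
η⁴ε⁴`, a divisor of 2 times a divisor of 4. -/
theorem exists_rat_of_mem_towerField (hi : i ^ 2 = -1) (hw : w ^ 4 = 2) (hu : u ^ 2 = 1 + i)
    {d : ℤ} (hd : d ≠ 0) (hδ : δ ^ 4 = d) (h : δ ∈ towerField i w u) :
    ∃ q : ℚ, ∃ c : ℤ, c ∣ 8 ∧ (d * c : ℚ) = q ^ 4 := by
  have hiF : i ∈ towerField i w u := left_mem_towerField
  have hwF : w ∈ towerField i w u := middle_mem_towerField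
  have hzF := one_add_div_sq_mem hiF (pow_mem hwF 2)
  have hz := sq_one_add_div_sq hi hw
  generalize (1 + i) / w ^ 2 = z at hzF hz
  have hδ0 : δ ≠ 0 := by
    rintro rfl
    apply hd
    have : (d : Ω) = 0 := by rw [← hδ]; simp
    exact_mod_cast this
  have hw0 : w ≠ 0 := by
    rintro rfl
    exact two_ne_zero (α := Ω) (by rw [← hw]; simp)
  have hi0 : i ≠ 0 := by
    rintro rfl
    simp at hi
  have hz0 : z ≠ 0 := by
    intro h0
    rw [h0] at hz
    exact hi0 (by simpa using hz.symm)
  have hinj := (algebraMap ℚ Ω).injective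
  have step : ∀ η : Ω, η ∈ towerField i w u → η ≠ 0 → ∀ c : ℤ, η ^ 4 = c → c ∣ 2 → ∀ q : ℚ,
      δ ^ 2 * η ^ 2 = algebraMap ℚ Ω q → ∃ q : ℚ, ∃ c : ℤ, c ∣ 8 ∧ (d * c : ℚ) = q ^ 4 := by
    intro η hη hη0 c hc hc2 q hq
    have hq0 : q ≠ 0 := by
      rintro rfl
      rw [map_zero] at hq
      exact mul_ne_zero (pow_ne_zero 2 hδ0) (pow_ne_zero 2 hη0) hq
    obtain ⟨r, hr⟩ := exists_rat_of_sq_mem_of_mem_towerField (D := δ * η) hi hw hu hq0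
      (by rw [← hq]; ring) (mul_mem h hη)
    have fin : ∀ (ε : Ω) (e : ℤ), ε ^ 4 = e → e ∣ 4 → δ * η * ε = algebraMap ℚ Ω r →
        ∃ q : ℚ, ∃ c : ℤ, c ∣ 8 ∧ (d * c : ℚ) = q ^ 4 := by
      intro ε e he he4 h'
      refine ⟨r, c * e, (mul_dvd_mul hc2 he4).trans (by norm_num), hinj ?_⟩
      rw [map_pow, ← h']
      push_cast
      simp only [map_intCast]
      rw [← hδ, ← hc, ← he]
      ring
    rcases hr with hr | hr | hr | hr
    · exact fin 1 1 (by simp) (by norm_num) (by rw [← hr]; ring)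
    · exact fin i 1 (by push_cast; linear_combination (i ^ 2 - 1) * hi) (by norm_num) hr
    · exact fin (w ^ 2) 4 (by push_cast; linear_combination (w ^ 4 + 2) * hw) (by norm_num) hr
    · exact fin (w ^ 2 * i) 4
        (by push_cast; linear_combination (w ^ 4 + 2) * hw + w ^ 8 * (i ^ 2 - 1) * hi)
        (by norm_num) (by rw [← hr]; ring)
  have hz4 : z ^ 4 = -1 := by
    rw [← hi, ← hz]
    ring
  have hD : (δ ^ 2) ^ 2 = algebraMap ℚ Ω d := by
    rw [map_intCast, ← hδ]
    ring
  obtain ⟨q, hq⟩ := exists_rat_of_sq_mem_of_mem_towerField hi hw hu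
    (by exact_mod_cast hd) hD (pow_mem h 2)
  rcases hq with hq | hq | hq | hq
  · exact step 1 (one_mem _) one_ne_zero 1 (by simp) (by norm_num) q (by rw [← hq]; ring)
  · exact step z hzF hz0 (-1) (by rw [hz4]; simp) (by norm_num) q (by rw [hz, hq])
  · exact step w hwF hw0 2 (by rw [hw]; simp) (by norm_num) q hq
  · exact step (w * z) (mul_mem hwF hzF) (mul_ne_zero hw0 hz0) (-2)
      (by push_cast; linear_combination w ^ 4 * hz4 - hw) (by norm_num) q
      (by rw [← hq, mul_pow, hz]; ring)

theorem sq_mem_towerField_iff (hi : i ^ 2 = -1) (hw : w ^ 4 = 2) (hu : u ^ 2 = 1 + i)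
    {d : ℤ} (hd : d ≠ 0) (hδ : δ ^ 4 = d) : δ ^ 2 ∈ towerField i w u ↔
      ∃ t : ℤ, d = t ^ 2 ∨ d = -t ^ 2 ∨ d = 2 * t ^ 2 ∨ d = -(2 * t ^ 2) := by
  have hD : (δ ^ 2) ^ 2 = algebraMap ℚ Ω d := by
    rw [map_intCast, ← hδ]
    ring
  have hinj := (algebraMap ℚ Ω).injective
  constructor
  · intro h
    obtain ⟨q, hq⟩ := exists_rat_of_sq_mem_of_mem_towerField hi hw hu
      (by exact_mod_cast hd) hD h
    have hint : ∀ n : ℤ, (n : ℚ) = q ^ 2 → ∃ m : ℤ, n = m ^ 2 := by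
      intro n hn
      have : IsSquare (n : ℚ) := ⟨q, by rw [hn, sq]⟩
      obtain ⟨m, hm⟩ := Rat.isSquare_intCast_iff.1 this
      exact ⟨m, by rw [hm, sq]⟩
    -- The factor `w ^ 2` yields that `2d` or `-2d` is a square; evenness of its root moves the 2 to
    -- the other side.
    have heven : ∀ n m : ℤ, 2 * n = m ^ 2 → ∃ k : ℤ, n = 2 * k ^ 2 := by
      intro n m h
      obtain ⟨k, rfl⟩ : 2 ∣ m := Int.prime_two.dvd_of_dvd_pow (Dvd.intro n h)
      exact ⟨k, by linarith⟩
    rcases hq with hq | hq | hq | hq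
    · obtain ⟨m, hm⟩ := hint d (hinj (by rw [map_pow, ← hq, ← hD]))
      exact ⟨m, Or.inl hm⟩
    · obtain ⟨m, hm⟩ := hint (-d) (hinj (by
        rw [map_pow, ← hq, map_intCast]
        push_cast
        linear_combination hδ - δ ^ 4 * hi))
      exact ⟨m, Or.inr (Or.inl (by linarith))⟩
    · obtain ⟨m, hm⟩ := hint (2 * d) (hinj (by
        rw [map_pow, ← hq, map_intCast]
        push_cast
        linear_combination -2 * hδ - δ ^ 4 * hw))
      obtain ⟨k, hk⟩ := heven d m hm
      exact ⟨k, Or.inr (Or.inr (Or.inl hk))⟩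
    · obtain ⟨m, hm⟩ := hint (2 * -d) (hinj (by
        rw [map_pow, ← hq, map_intCast]
        push_cast
        linear_combination 2 * hδ + δ ^ 4 * hw - δ ^ 4 * w ^ 4 * hi))
      obtain ⟨k, hk⟩ := heven (-d) m hm
      exact ⟨k, Or.inr (Or.inr (Or.inr (by linarith)))⟩
  · rintro ⟨t, ht⟩
    have hiF : i ∈ towerField i w u := left_mem_towerField
    have hwF : w ^ 2 ∈ towerField i w u := pow_mem middle_mem_towerField 2
    have htF : (t : Ω) ∈ towerField i w u := intCast_mem _ t
    rw [map_intCast] at hD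
    rcases ht with rfl | rfl | rfl | rfl <;> push_cast at hD
    · exact mem_of_sq_eq_sq htF hD
    · exact mem_of_sq_eq_sq (mul_mem hiF htF) (by linear_combination hD - (t : Ω) ^ 2 * hi)
    · exact mem_of_sq_eq_sq (mul_mem hwF htF) (by linear_combination hD - (t : Ω) ^ 2 * hw)
    · exact mem_of_sq_eq_sq (mul_mem hwF (mul_mem hiF htF))
        (by linear_combination hD + (t : Ω) ^ 2 * hw - w ^ 4 * (t : Ω) ^ 2 * hi)

theorem finrank_towerField_sup_of_mem (hi : i ^ 2 = -1) (hw : w ^ 4 = 2) (hu : u ^ 2 = 1 + i)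
    (h : δ ∈ towerField i w u) :
    Module.finrank ℚ ↥(towerField i w u ⊔ ℚ⟮δ ^ 2⟯ ⊔ ℚ⟮δ⟯) = 16 := by
  rw [finrank_sup_adjoin_simple_of_mem ((le_sup_left : towerField i w u ≤ _) h),
    finrank_sup_adjoin_simple_of_mem (pow_mem h 2), finrank_towerField hi hw hu]

theorem finrank_towerField_sup_of_sq_mem (hi : i ^ 2 = -1) (hw : w ^ 4 = 2) (hu : u ^ 2 = 1 + i)
    (h : δ ∉ towerField i w u) (h2 : δ ^ 2 ∈ towerField i w u) :
    Module.finrank ℚ ↥(towerField i w u ⊔ ℚ⟮δ ^ 2⟯ ⊔ ℚ⟮δ⟯) = 32 := by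
  rw [sup_eq_left.2 (adjoin_simple_le_iff.2 h2),
    finrank_sup_adjoin_simple_of_notMem h2 h, finrank_towerField hi hw hu]

theorem finrank_towerField_sup_of_sq_notMem (hi : i ^ 2 = -1) (hw : w ^ 4 = 2) (hu : u ^ 2 = 1 + i)
    {d : ℤ} (hδ : δ ^ 4 = d) (h2 : δ ^ 2 ∉ towerField i w u) :
    Module.finrank ℚ ↥(towerField i w u ⊔ ℚ⟮δ ^ 2⟯ ⊔ ℚ⟮δ⟯) = 64 := by
  have h4 : (δ ^ 2) ^ 2 ∈ towerField i w u := by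
    rw [← pow_mul, hδ]
    exact intCast_mem _ d
  rw [finrank_sup_adjoin_simple_of_notMem, finrank_sup_adjoin_simple_of_notMem h4 h2,
    finrank_towerField hi hw hu]
  · exact (le_sup_right : ℚ⟮δ ^ 2⟯ ≤ _) (mem_adjoin_simple_self ℚ _)
  · exact notMem_sup_adjoin_simple_of_sq_eq_mul (c := 1) hi left_mem_towerField h4 h2
      (one_mem _) one_ne_zero (by ring)

end Radical

/-! ### Arithmetic of fourth-power-free integers. -/

section FourthPowerFree

theorem FourthPowerFree.squarefree_of_sq_dvd {d t : ℤ} (hd : FourthPowerFree d)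
    (h : t ^ 2 ∣ d) : Squarefree t := by
  rw [← Int.squarefree_natAbs, Nat.squarefree_iff_prime_squarefree]
  intro p hp hpt
  apply hd p hp
  have h1 : (p : ℤ) * p ∣ t := by
    rw [← Int.dvd_natAbs]
    exact_mod_cast hpt
  calc (p : ℤ) ^ 4 = (p * p) ^ 2 := by ring
    _ ∣ t ^ 2 := pow_dvd_pow_of_dvd h1 2
    _ ∣ d := h

/-- An odd prime p dividing m is prime to c, so `p⁴ ∣ d`; and `4 ∣ m` would leave `2⁵ ∣ d` after
removing `c ∣ 8`. Hence m is ±1 or ±2, and `dc` is 1 or 16. -/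
theorem FourthPowerFree.mem_of_mul_eq_pow {d c m : ℤ} (hd : FourthPowerFree d) (hd0 : d ≠ 0)
    (hc : c ∣ 8) (h : d * c = m ^ 4) : d ∈ ({1, -1, 2, -2, 4, -4, 8, -8} : Set ℤ) := by
  have hc0 : c ≠ 0 := by
    rintro rfl
    norm_num at hc
  have hm0 : m ≠ 0 := by
    rintro rfl
    simp_all
  obtain ⟨k, n, hn, hkn⟩ := Nat.exists_eq_two_pow_mul_odd (Int.natAbs_ne_zero.2 hm0)
  have hm4 : m ^ 4 = (2 ^ k * n : ℤ) ^ 4 := by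
    rw [← Even.pow_abs (by decide : Even 4) m, Int.abs_eq_natAbs, hkn]
    push_cast
    rfl
  have hn1 : n = 1 := by
    by_contra hne
    obtain ⟨p, hp, hpn⟩ := Nat.exists_prime_and_dvd hne
    have hp2 : p ≠ 2 := by
      rintro rfl
      exact Nat.not_even_iff_odd.2 hn (even_iff_two_dvd.2 hpn)
    apply hd p hp
    have hcop : IsCoprime ((p : ℤ) ^ 4) c := by
      refine IsCoprime.of_isCoprime_of_dvd_right ?_ hc
      have h8 : IsCoprime ((p ^ 4 : ℕ) : ℤ) ((2 ^ 3 : ℕ) : ℤ) :=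
        Nat.isCoprime_iff_coprime.2
          (Nat.Coprime.pow 4 3 ((Nat.coprime_primes hp Nat.prime_two).2 hp2))
      exact_mod_cast h8
    refine hcop.dvd_of_dvd_mul_right ?_
    rw [h, hm4]
    exact pow_dvd_pow_of_dvd (Dvd.dvd.mul_left (by exact_mod_cast hpn) _) 4
  subst hn1
  have hk : k ≤ 1 := by
    by_contra hk
    apply hd 2 Nat.prime_two
    obtain ⟨j, rfl⟩ : ∃ j, k = 2 + j := Nat.exists_eq_add_of_le (by omega)
    obtain ⟨e, he⟩ := hc
    have : d * 8 = 16 * (2 ^ j) ^ 4 * e * 16 := by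
      rw [he, ← mul_assoc, h, hm4]
      push_cast
      ring
    exact ⟨2 * (2 ^ j) ^ 4 * e, by push_cast; linarith⟩
  have hdc : d * c = 1 ∨ d * c = 16 := by
    rw [h, hm4]
    interval_cases k <;> simp
  have h16 : ¬ (16 : ℤ) ∣ d := by simpa using hd 2 Nat.prime_two
  have hc8 : c.natAbs ≤ 8 := Nat.le_of_dvd (by norm_num) (by simpa using Int.natAbs_dvd_natAbs.2 hc)
  have hlo : -8 ≤ c := by omega
  have hhi : c ≤ 8 := by omega
  simp only [Set.mem_insert_iff, Set.mem_singleton_iff]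
  interval_cases c <;> omega

end FourthPowerFree

theorem mem_towerField_iff {Ω : Type*} [Field Ω] [Algebra ℚ Ω] [CharZero Ω]
    [Algebra.IsAlgebraic ℚ Ω] {i w u δ : Ω} (hi : i ^ 2 = -1) (hw : w ^ 4 = 2) (hu : u ^ 2 = 1 + i)
    {d : ℤ} (hd0 : d ≠ 0) (hd : FourthPowerFree d) (hδ : δ ^ 4 = d) :
    δ ∈ towerField i w u ↔ d ∈ ({1, -1, 2, -2, 4, -4, 8, -8} : Set ℤ) := by
  refine ⟨fun h => ?_, mem_towerField_of_pow_four_eq hi hw hδ⟩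
  obtain ⟨q, c, hc, hq⟩ := exists_rat_of_mem_towerField hi hw hu hd0 hδ h
  have hqi : IsIntegral ℤ q := by
    refine IsIntegral.of_pow (n := 4) (by norm_num) ?_
    rw [← hq]
    exact_mod_cast isIntegral_algebraMap (R := ℤ) (A := ℚ) (x := d * c)
  obtain ⟨m, rfl⟩ := IsIntegrallyClosed.isIntegral_iff.1 hqi
  exact hd.mem_of_mul_eq_pow hd0 hc (m := m) (by
    rw [eq_intCast] at hq
    exact_mod_cast hq)

/-- The values t = ±1, ±2 produce exactly the eight exceptional d, and `|t| ≥ 3` overshoots them;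
squarefreeness of t is automatic since `t² ∣ d`. -/
theorem exists_squarefree_iff {d : ℤ} (hd : FourthPowerFree d) :
    (∃ t : ℤ, Squarefree t ∧ t ∉ ({1, -1, 2, -2} : Set ℤ) ∧
        (d = t ^ 2 ∨ d = -t ^ 2 ∨ d = 2 * t ^ 2 ∨ d = -(2 * t ^ 2))) ↔
      d ∉ ({1, -1, 2, -2, 4, -4, 8, -8} : Set ℤ) ∧
      ∃ t : ℤ, d = t ^ 2 ∨ d = -t ^ 2 ∨ d = 2 * t ^ 2 ∨ d = -(2 * t ^ 2) := by
  constructor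
  · rintro ⟨t, hsq, ht, h⟩
    refine ⟨fun hmem => ?_, t, h⟩
    have ht0 := hsq.ne_zero
    simp only [Set.mem_insert_iff, Set.mem_singleton_iff] at ht hmem
    have : 9 ≤ t ^ 2 := by
      rcases (by omega : t ≤ -3 ∨ 3 ≤ t) with h | h <;> nlinarith
    omega
  · rintro ⟨hmem, t, h⟩
    refine ⟨t, hd.squarefree_of_sq_dvd ?_, fun ht => hmem ?_, h⟩
    · rcases h with h | h | h | h
      · exact ⟨1, by linarith⟩
      · exact ⟨-1, by linarith⟩
      · exact ⟨2, by linarith⟩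
      · exact ⟨-2, by linarith⟩
    · simp only [Set.mem_insert_iff, Set.mem_singleton_iff] at ht ⊢
      rcases ht with rfl | rfl | rfl | rfl <;> norm_num at h <;> omega

/-- The Weierstrass curve `y ^ 2 = x * (x - s) * (x + s)`. -/
def splitCurve {F : Type*} [Field F] (s : F) : WeierstrassCurve.Affine F :=
  ⟨0, 0, 0, -s ^ 2, 0⟩

/-! ### Halving points on `y² = x(x - s)(x + s)`. -/

namespace splitCurve

open WeierstrassCurve.Affine WeierstrassCurve.Affine.Point

variable {F : Type*} [Field F] {s : F}

theorem negY_eq (x y : F) : (splitCurve s).negY x y = -y := by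
  simp [WeierstrassCurve.Affine.negY, splitCurve]

open scoped Classical in
theorem two_nsmul_of_eq_zero {x y : F} (h : (splitCurve s).Nonsingular x y) (hy : y = 0) :
    2 • some x y h = 0 := by
  rw [two_nsmul]
  exact add_self_of_Y_eq (by rw [negY_eq, hy, _root_.neg_zero])

/-- For `x = (a+b)(a+c)`, the factors x, x - s, x + s are the pairwise products of a+b, a+c, b+c, so
their product is visibly a square. -/
theorem half_add_mul_sub {a b c : F} (hb : b ^ 2 = a ^ 2 - s) :
    (a + b) * (a + c) - s = (a + b) * (b + c) := by
  linear_combination -hb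

theorem half_add_mul_add {a b c : F} (hc : c ^ 2 = a ^ 2 + s) :
    (a + b) * (a + c) + s = (a + c) * (b + c) := by
  linear_combination -hc

variable [NeZero (2 : F)]

theorem half_parameters_ne_zero (hs : s ≠ 0) {a b c : F} (hb : b ^ 2 = a ^ 2 - s)
    (hc : c ^ 2 = a ^ 2 + s) : (a + b) * (a + c) * (b + c) ≠ 0 := by
  have h2 : (2 : F) ≠ 0 := NeZero.ne 2
  refine mul_ne_zero (mul_ne_zero ?_ ?_) ?_ <;> intro h0
  · apply hs
    linear_combination (a - b) * h0 + hb
  · apply hs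
    linear_combination (c - a) * h0 - hc
  · have : 2 * s = 0 := by linear_combination (c - b) * h0 - hc + hb
    exact hs ((mul_eq_zero.1 this).resolve_left h2)

theorem nonsingular_iff (hs : s ≠ 0) {x y : F} :
    (splitCurve s).Nonsingular x y ↔ y ^ 2 = x ^ 3 - s ^ 2 * x := by
  rw [WeierstrassCurve.Affine.nonsingular_iff', WeierstrassCurve.Affine.equation_iff]
  simp only [splitCurve]
  constructor
  · rintro ⟨h, -⟩
    linear_combination h
  · intro h
    refine ⟨by linear_combination h, ?_⟩
    by_contra hcon
    push Not at hcon
    obtain ⟨h1, h2⟩ := hcon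
    have hy : y = 0 := by
      have : 2 * y = 0 := by linear_combination h2
      exact (mul_eq_zero.1 this).resolve_left (NeZero.ne 2)
    subst hy
    have h3 : 2 * x * s ^ 2 = 0 := by linear_combination (3 : F) * h - x * h1
    have hx : x = 0 := by
      rcases mul_eq_zero.1 h3 with h3 | h3
      · exact (mul_eq_zero.1 h3).resolve_left (NeZero.ne 2)
      · exact absurd (pow_eq_zero_iff two_ne_zero |>.1 h3) hs
    subst hx
    apply hs
    have : s ^ 2 = 0 := by linear_combination h1
    exact pow_eq_zero_iff two_ne_zero |>.1 this

theorem ne_negY {x y : F} (hy : y ≠ 0) : y ≠ (splitCurve s).negY x y := by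
  rw [negY_eq]
  intro h
  have : 2 * y = 0 := by linear_combination h
  exact hy ((mul_eq_zero.1 this).resolve_left (NeZero.ne 2))

open scoped Classical in
theorem two_nsmul_eq_zero_iff {x y : F} (h : (splitCurve s).Nonsingular x y) :
    2 • some x y h = 0 ↔ y = 0 := by
  refine ⟨fun h2 => ?_, two_nsmul_of_eq_zero h⟩
  by_contra hy
  rw [two_nsmul, add_self_of_Y_ne (ne_negY hy)] at h2
  exact some_ne_zero _ h2

open scoped Classical in
-- The tangent at the half has slope `a + b + c`, and `(a+b+c)² - 2(a+b)(a+c) = b² + c² - a² = a²`.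
theorem two_nsmul_some (hs : s ≠ 0) {a b c : F} (hb : b ^ 2 = a ^ 2 - s) (hc : c ^ 2 = a ^ 2 + s)
    (h : (splitCurve s).Nonsingular ((a + b) * (a + c)) ((a + b) * (a + c) * (b + c))) :
    ∃ h' : (splitCurve s).Nonsingular (a ^ 2) (a * b * c), 2 • some _ _ h = some _ _ h' := by
  have h2 : (2 : F) ≠ 0 := NeZero.ne 2
  have hy : (a + b) * (a + c) * (b + c) ≠ 0 := half_parameters_ne_zero hs hb hc
  have e1 := half_add_mul_sub (c := c) hb
  have e2 := half_add_mul_add (b := b) hc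
  have hslope : (splitCurve s).slope ((a + b) * (a + c)) ((a + b) * (a + c))
      ((a + b) * (a + c) * (b + c)) ((a + b) * (a + c) * (b + c)) = a + b + c := by
    rw [slope_of_Y_ne rfl (ne_negY hy), negY_eq, sub_neg_eq_add, ← two_mul,
      div_eq_iff (mul_ne_zero h2 hy)]
    simp only [splitCurve]
    linear_combination ((a + b) * (a + c)) * e1 + ((a + b) * (a + c)) * e2 +
      ((a + b) * (a + c) + s) * e1 + (a + b) * (b + c) * e2
  have hX : (splitCurve s).addX ((a + b) * (a + c)) ((a + b) * (a + c)) (a + b + c) = a ^ 2 := by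
    simp only [WeierstrassCurve.Affine.addX, splitCurve]
    linear_combination hb + hc
  have hY : (splitCurve s).addY ((a + b) * (a + c)) ((a + b) * (a + c))
      ((a + b) * (a + c) * (b + c)) (a + b + c) = a * b * c := by
    rw [WeierstrassCurve.Affine.addY, negY_eq, WeierstrassCurve.Affine.negAddY, hX]
    ring
  have hns : (splitCurve s).Nonsingular (a ^ 2) (a * b * c) := by
    rw [nonsingular_iff hs]
    linear_combination a ^ 2 * c ^ 2 * hb + a ^ 2 * (a ^ 2 - s) * hc
  refine ⟨hns, ?_⟩
  rw [two_nsmul, add_self_of_Y_ne (ne_negY hy)]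
  simp only [hslope, hX, hY]

theorem nonsingular_half (hs : s ≠ 0) {a b c : F} (hb : b ^ 2 = a ^ 2 - s)
    (hc : c ^ 2 = a ^ 2 + s) :
    (splitCurve s).Nonsingular ((a + b) * (a + c)) ((a + b) * (a + c) * (b + c)) := by
  have e1 := half_add_mul_sub (c := c) hb
  have e2 := half_add_mul_add (b := b) hc
  rw [nonsingular_iff hs]
  linear_combination -((a + b) * (a + c)) * (((a + b) * (a + c) + s) * e1 +
    (a + b) * (b + c) * e2)

theorem exists_half_parameters (hs : s ≠ 0) {x y : F} (h : (splitCurve s).Nonsingular x y)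
    (hy : y ≠ 0) : ∃ a b c : F, b ^ 2 = a ^ 2 - s ∧ c ^ 2 = a ^ 2 + s ∧
      x = (a + b) * (a + c) ∧ y = (a + b) * (a + c) * (b + c) := by
  rw [nonsingular_iff hs] at h
  have h2 : (2 : F) ≠ 0 := NeZero.ne 2
  have hab : (x ^ 2 + s ^ 2) / (2 * y) + (x ^ 2 - 2 * s * x - s ^ 2) / (2 * y) =
      x * (x - s) / y := by
    field_simp
    ring
  have hac : (x ^ 2 + s ^ 2) / (2 * y) + (x ^ 2 + 2 * s * x - s ^ 2) / (2 * y) =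
      x * (x + s) / y := by
    field_simp
    ring
  have hbc : (x ^ 2 - 2 * s * x - s ^ 2) / (2 * y) + (x ^ 2 + 2 * s * x - s ^ 2) / (2 * y) =
      (x ^ 2 - s ^ 2) / y := by
    field_simp
    ring
  -- Solution of the linear system `a+b = x(x-s)/y`, `a+c = x(x+s)/y`, `b+c = (x²-s²)/y`.
  refine ⟨(x ^ 2 + s ^ 2) / (2 * y), (x ^ 2 - 2 * s * x - s ^ 2) / (2 * y),
    (x ^ 2 + 2 * s * x - s ^ 2) / (2 * y), ?_, ?_, ?_, ?_⟩
  · rw [div_pow, div_pow, eq_sub_iff_add_eq, div_add' _ _ _ (pow_ne_zero 2 (mul_ne_zero h2 hy))]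
    congr 1
    linear_combination 4 * s * h
  · rw [div_pow, div_pow, ← sub_eq_iff_eq_add, div_sub' (pow_ne_zero 2 (mul_ne_zero h2 hy))]
    congr 1
    linear_combination -4 * s * h
  · rw [hab, hac, div_mul_div_comm, eq_div_iff (mul_ne_zero hy hy)]
    linear_combination x * h
  · rw [hab, hac, hbc, div_mul_div_comm, div_mul_div_comm,
      eq_div_iff (mul_ne_zero (mul_ne_zero hy hy) hy)]
    linear_combination (y ^ 2 + x ^ 3 - s ^ 2 * x) * h

/-- The coordinates of a halved point determine its parameters. -/
theorem half_parameters_eq (hs : s ≠ 0) {a b c : F} (hb : b ^ 2 = a ^ 2 - s)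
    (hc : c ^ 2 = a ^ 2 + s) {x y : F} (hx : x = (a + b) * (a + c))
    (hy : y = (a + b) * (a + c) * (b + c)) :
    a = (x ^ 2 + s ^ 2) / (2 * y) ∧ b = (x ^ 2 - 2 * s * x - s ^ 2) / (2 * y) ∧
      c = (x ^ 2 + 2 * s * x - s ^ 2) / (2 * y) := by
  have h2 : (2 : F) ≠ 0 := NeZero.ne 2
  have hy0 : 2 * y ≠ 0 := by
    rw [hy]
    exact mul_ne_zero h2 (half_parameters_ne_zero hs hb hc)
  have e1 : x - s = (a + b) * (b + c) := hx ▸ half_add_mul_sub hb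
  have e2 : x + s = (a + c) * (b + c) := hx ▸ half_add_mul_add hc
  have p1 : x * (x - s) = y * (a + b) := by rw [e1, hx, hy]; ring
  have p2 : x * (x + s) = y * (a + c) := by rw [e2, hx, hy]; ring
  have p3 : (x - s) * (x + s) = y * (b + c) := by rw [e1, e2, hy]; ring
  rw [eq_div_iff hy0, eq_div_iff hy0, eq_div_iff hy0]
  refine ⟨?_, ?_, ?_⟩
  · linear_combination p3 - p1 - p2
  · linear_combination p2 - p1 - p3
  · linear_combination p1 - p2 - p3

end splitCurve

/-! ### The field generated by the 8-torsion. -/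

namespace splitCurve

open WeierstrassCurve.Affine WeierstrassCurve.Affine.Point

variable {k Ω : Type*} [Field k] [Field Ω] [Algebra k Ω] [NeZero (2 : Ω)] {s : Ω}

open scoped Classical in
theorem half_parameters_mem_of_torsion_mem (hs : s ≠ 0) {F : IntermediateField k Ω} (hsF : s ∈ F)
    (hF : ∀ x y h, 8 • some (W' := splitCurve s) x y h = 0 → x ∈ F ∧ y ∈ F) {x y : Ω}
    (h : (splitCurve s).Nonsingular x y) (h4 : 4 • some x y h = 0) {a b c : Ω} (ha : a ^ 2 = x)
    (hb : b ^ 2 = x - s) (hc : c ^ 2 = x + s) : a ∈ F ∧ b ∈ F ∧ c ∈ F := by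
  subst ha
  -- The roots give a half of the point itself only when their product is y; replacing a by -a
  -- arranges this.
  have key : ∀ a' : Ω, a' ^ 2 = a ^ 2 → a' * b * c = y → a' ∈ F ∧ b ∈ F ∧ c ∈ F := by
    intro a' ha' hy
    rw [← ha'] at hb hc
    have hns := nonsingular_half hs hb hc
    obtain ⟨h', hP⟩ := two_nsmul_some hs hb hc hns
    have h8 : 8 • some _ _ hns = 0 := by
      rw [show (8 : ℕ) = 4 * 2 from rfl, mul_nsmul', hP]
      convert h4 using 3
    obtain ⟨hxF, hyF⟩ := hF _ _ _ h8
    obtain ⟨h1, h2, h3⟩ := half_parameters_eq hs hb hc rfl rfl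
    have h2F : (2 : Ω) ∈ F := ofNat_mem F 2
    have hx2 := pow_mem hxF 2
    have hs2 := pow_mem hsF 2
    have hxs := F.mul_mem (F.mul_mem h2F hsF) hxF
    have hyy := F.mul_mem h2F hyF
    refine ⟨?_, ?_, ?_⟩
    · rw [h1]
      exact F.div_mem (F.add_mem hx2 hs2) hyy
    · rw [h2]
      exact F.div_mem (F.sub_mem (F.sub_mem hx2 hxs) hs2) hyy
    · rw [h3]
      exact F.div_mem (F.sub_mem (F.add_mem hx2 hxs) hs2) hyy
  have hsq : y ^ 2 = (a * b * c) ^ 2 := by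
    rw [(nonsingular_iff hs).1 h]
    linear_combination -a ^ 2 * c ^ 2 * hb - a ^ 2 * (a ^ 2 - s) * hc
  rcases sq_eq_sq_iff_eq_or_eq_neg.1 hsq with hy | hy
  · exact key a rfl hy.symm
  · obtain ⟨h1, h2, h3⟩ := key (-a) (by ring) (by rw [hy]; ring)
    exact ⟨by simpa using F.neg_mem h1, h2, h3⟩

variable {i w u δ : Ω}

open scoped Classical in
theorem mem_of_eight_torsion_subset (hi : i ^ 2 = -1) (hw : w ^ 4 = 2) (hu : u ^ 2 = 1 + i)
    (hδ : δ ≠ 0) {F : IntermediateField k Ω}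
    (hF : ∀ x y h, 8 • some (W' := splitCurve (i * δ ^ 2)) x y h = 0 → x ∈ F ∧ y ∈ F) :
    i ∈ F ∧ w ∈ F ∧ u ∈ F ∧ δ ∈ F := by
  have hi0 : i ≠ 0 := by
    rintro rfl
    simp at hi
  have h2 : (2 : Ω) ≠ 0 := NeZero.ne 2
  have hw0 : w ≠ 0 := by
    rintro rfl
    exact h2 (by rw [← hw]; simp)
  have hs : i * δ ^ 2 ≠ 0 := mul_ne_zero hi0 (pow_ne_zero 2 hδ)
  have hz : ((1 + i) / w ^ 2) ^ 2 = i := by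
    rw [div_pow, div_eq_iff (pow_ne_zero 2 (pow_ne_zero 2 hw0))]
    linear_combination hi - i * hw
  have hzmem : ∀ {F : IntermediateField k Ω}, i ∈ F → w ^ 2 ∈ F → (1 + i) / w ^ 2 ∈ F :=
    fun hiF hwF => div_mem (add_mem (one_mem _) hiF) hwF
  have hzw : (1 + i) / w ^ 2 * w ^ 2 = 1 + i := div_mul_cancel₀ _ (pow_ne_zero 2 hw0)
  generalize (1 + i) / w ^ 2 = z at hz hzmem hzw
  have hz0 : z ≠ 0 := by
    rintro rfl
    exact hi0 (by rw [← hz]; simp)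
  have hmul8 : ∀ (x : Ω) h, 4 • some (W' := splitCurve (i * δ ^ 2)) x 0 h = 0 := by
    intro x h
    rw [show (4 : ℕ) = 2 * 2 from rfl, mul_nsmul', two_nsmul_of_eq_zero h rfl, nsmul_zero]
  have n0 : (splitCurve (i * δ ^ 2)).Nonsingular 0 0 := by
    rw [nonsingular_iff hs]
    ring
  have ns : (splitCurve (i * δ ^ 2)).Nonsingular (i * δ ^ 2) 0 := by
    rw [nonsingular_iff hs]
    ring
  have nns : (splitCurve (i * δ ^ 2)).Nonsingular (-(i * δ ^ 2)) 0 := by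
    rw [nonsingular_iff hs]
    ring
  have hsF : i * δ ^ 2 ∈ F := by
    refine (hF _ _ ns ?_).1
    rw [show (8 : ℕ) = 2 * 4 from rfl, mul_nsmul', hmul8, nsmul_zero]
  -- Here z is an eighth root of unity and `s = (zδ)²`. Halving (0, 0) yields √(-s) and √s, hence
  -- their ratio i.
  obtain ⟨-, hizF, hzF⟩ := half_parameters_mem_of_torsion_mem hs hsF hF n0 (hmul8 _ _)
    (a := 0) (b := i * (z * δ)) (c := z * δ) (by ring)
    (by linear_combination z ^ 2 * δ ^ 2 * hi - δ ^ 2 * hz) (by linear_combination δ ^ 2 * hz)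
  have hzδ : z * δ ≠ 0 := mul_ne_zero hz0 hδ
  have hiF : i ∈ F := by
    rw [← mul_div_cancel_right₀ i hzδ]
    exact F.div_mem hizF hzF
  -- Halving (-s, 0) yields √(-2s), hence √2 = `w ^ 2`; then z and δ follow.
  obtain ⟨-, hwzF, -⟩ := half_parameters_mem_of_torsion_mem hs hsF hF nns (hmul8 _ _)
    (a := i * (z * δ)) (b := w ^ 2 * (i * (z * δ))) (c := 0)
    (by linear_combination z ^ 2 * δ ^ 2 * hi - δ ^ 2 * hz)
    (by linear_combination 2 * (z ^ 2 * δ ^ 2 * hi - δ ^ 2 * hz) + (i * z * δ) ^ 2 * hw) (by ring)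
  have hw2F : w ^ 2 ∈ F := by
    rw [← mul_div_cancel_right₀ (w ^ 2) (mul_ne_zero hi0 hzδ)]
    exact F.div_mem hwzF hizF
  have hz1F : z ∈ F := hzmem hiF hw2F
  have hδF : δ ∈ F := by
    rw [← mul_div_cancel_left₀ δ hz0]
    exact F.div_mem hzF hz1F
  have four : ∀ a b c : Ω, ∀ (hb : b ^ 2 = a ^ 2 - i * δ ^ 2) (hc : c ^ 2 = a ^ 2 + i * δ ^ 2),
      a * b * c = 0 → 4 • some _ _ (nonsingular_half hs hb hc) = 0 := by
    intro a b c hb hc habc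
    obtain ⟨h', hP⟩ := two_nsmul_some hs hb hc (nonsingular_half hs hb hc)
    rw [show (4 : ℕ) = 2 * 2 from rfl, mul_nsmul', hP]
    exact two_nsmul_of_eq_zero h' habc
  have hu0 : u ≠ 0 := by
    rintro rfl
    apply h2
    linear_combination (i - 1) * hu + hi
  have hw4 : (w ^ 2 / u) ^ 2 = 1 - i := by
    rw [div_pow, div_eq_iff (pow_ne_zero 2 hu0)]
    linear_combination hw - (1 - i) * hu + hi
  -- A half of (0, 0) has `x = is = -δ²`, so `x - s = -δ²(1 + i)`, whose root involves u.
  have huF : i * δ * u ∈ F := by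
    refine (half_parameters_mem_of_torsion_mem hs hsF hF _
      (four 0 (i * (z * δ)) (z * δ) ?_ ?_ ?_) (a := i * δ) (b := i * δ * u)
      (c := i * δ * (w ^ 2 / u)) ?_ ?_ ?_).2.1
    · linear_combination z ^ 2 * δ ^ 2 * hi - δ ^ 2 * hz
    · linear_combination δ ^ 2 * hz
    · ring
    · linear_combination -i * δ ^ 2 * hz
    · linear_combination i ^ 2 * δ ^ 2 * hu - i * δ ^ 2 * hz + i * δ ^ 2 * hi
    · linear_combination i ^ 2 * δ ^ 2 * hw4 - i * δ ^ 2 * hz - i * δ ^ 2 * hi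
  have hq : ((1 + z) / u) ^ 2 = 1 + w ^ 2 := by
    rw [div_pow, div_eq_iff (pow_ne_zero 2 hu0)]
    linear_combination hz - z * hw + w ^ 2 * hzw - (1 + w ^ 2) * hu
  -- A half of (s, 0) has `x = s(1 + √2)`, so `x - s = s√2`, whose root involves w.
  have hwF : w * (z * δ) ∈ F := by
    refine (half_parameters_mem_of_torsion_mem hs hsF hF _
      (four (z * δ) 0 (w ^ 2 * (z * δ)) ?_ ?_ ?_) (a := z * δ * ((1 + z) / u)) (b := w * (z * δ))
      (c := w * (z * δ) * ((1 + z) / u)) ?_ ?_ ?_).2.1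
    · linear_combination -δ ^ 2 * hz
    · linear_combination z ^ 2 * δ ^ 2 * hw + δ ^ 2 * hz
    · ring
    · linear_combination z ^ 2 * δ ^ 2 * hq
    · linear_combination -δ ^ 2 * hz
    · linear_combination w ^ 2 * z ^ 2 * δ ^ 2 * hq + z ^ 2 * δ ^ 2 * hw + δ ^ 2 * hz
  refine ⟨hiF, ?_, ?_, hδF⟩
  · rw [← mul_div_cancel_right₀ w hzδ]
    exact F.div_mem hwF hzF
  · rw [← mul_div_cancel_left₀ u (mul_ne_zero hi0 hδ)]
    exact F.div_mem huF (F.mul_mem hiF hδF)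

open scoped Classical in
/-- Over a field containing `i`, a fourth root of `2`, a square root of `1 + i` and a square root
`g` of `s`, every point killed by `4` can be halved. -/
theorem sqrt_mem_of_four_nsmul_eq_zero (hi : i ^ 2 = -1) (hw : w ^ 4 = 2) (hu : u ^ 2 = 1 + i)
    {g : Ω} (hg : g ≠ 0) {F : IntermediateField k Ω} (hiF : i ∈ F) (hwF : w ∈ F) (huF : u ∈ F)
    (hgF : g ∈ F) {x y : Ω} (h : (splitCurve (g ^ 2)).Nonsingular x y)
    (h4 : 4 • some x y h = 0) {a b c : Ω} (ha : a ^ 2 = x) (hb : b ^ 2 = x - g ^ 2)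
    (hc : c ^ 2 = x + g ^ 2) : a ∈ F ∧ b ∈ F ∧ c ∈ F := by
  have hi0 : i ≠ 0 := by
    rintro rfl
    simp at hi
  have h2 : (2 : Ω) ≠ 0 := NeZero.ne 2
  have hw0 : w ≠ 0 := by
    rintro rfl
    exact h2 (by rw [← hw]; simp)
  have hu0 : u ≠ 0 := by
    rintro rfl
    apply h2
    linear_combination (i - 1) * hu + hi
  have hs : g ^ 2 ≠ 0 := pow_ne_zero 2 hg
  obtain ⟨z, hzF, hzw⟩ : ∃ z ∈ F, z * w ^ 2 = 1 + i :=
    ⟨(1 + i) / w ^ 2, div_mem (add_mem (one_mem _) hiF) (pow_mem hwF 2),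
      div_mul_cancel₀ _ (pow_ne_zero 2 hw0)⟩
  have hz : z ^ 2 = i := by
    have : 2 * z ^ 2 = 2 * i := by
      linear_combination -z ^ 2 * hw + (z * w ^ 2 + 1 + i) * hzw + hi
    exact mul_left_cancel₀ h2 this
  obtain ⟨v, hvF, hv⟩ : ∃ v ∈ F, v ^ 2 = 1 - i := by
    refine ⟨w ^ 2 / u, div_mem (pow_mem hwF 2) huF, ?_⟩
    rw [div_pow, div_eq_iff (pow_ne_zero 2 hu0)]
    linear_combination hw - (1 - i) * hu + hi
  obtain ⟨p, hpF, hp⟩ : ∃ p ∈ F, p ^ 2 = 1 + w ^ 2 := by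
    refine ⟨(1 + z) / u, div_mem (add_mem (one_mem _) hzF) huF, ?_⟩
    rw [div_pow, div_eq_iff (pow_ne_zero 2 hu0)]
    linear_combination hz - z * hw + w ^ 2 * hzw - (1 + w ^ 2) * hu
  have hp0 : p ≠ 0 := by
    rintro rfl
    have : (1 : Ω) = 0 := by linear_combination (1 - w ^ 2) * hp - hw
    exact one_ne_zero this
  -- `(√2 - 1)(√2 + 1) = 1`, so one square root gives the other.
  obtain ⟨m, hmF, hm⟩ : ∃ m ∈ F, m ^ 2 = w ^ 2 - 1 := by
    refine ⟨1 / p, div_mem (one_mem _) hpF, ?_⟩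
    rw [div_pow, div_eq_iff (pow_ne_zero 2 hp0)]
    linear_combination (1 - w ^ 2) * hp - hw
  have mem : ∀ {t r : Ω}, r ∈ F → t ^ 2 = r ^ 2 → t ∈ F := by
    intro t r hr ht
    rcases sq_eq_sq_iff_eq_or_eq_neg.1 ht with rfl | rfl
    · exact hr
    · exact neg_mem hr
  have hw2F : w ^ 2 ∈ F := pow_mem hwF 2
  have h0F : (0 : Ω) ∈ F := zero_mem F
  by_cases hy : y = 0
  · subst hy
    have hx : x * ((x - g ^ 2) * (x + g ^ 2)) = 0 := by
      linear_combination -(nonsingular_iff hs).1 h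
    rcases mul_eq_zero.1 hx with hx | hx
    · refine ⟨mem h0F ?_, mem (mul_mem hiF hgF) ?_, mem hgF ?_⟩
      · linear_combination ha + hx
      · linear_combination hb + hx - g ^ 2 * hi
      · linear_combination hc + hx
    rcases mul_eq_zero.1 hx with hx | hx
    · refine ⟨mem hgF ?_, mem h0F ?_, mem (mul_mem hw2F hgF) ?_⟩
      · linear_combination ha + hx
      · linear_combination hb + hx
      · linear_combination hc + hx - g ^ 2 * hw
    · refine ⟨mem (mul_mem hiF hgF) ?_, mem (mul_mem hw2F (mul_mem hiF hgF)) ?_, mem h0F ?_⟩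
      · linear_combination ha + hx - g ^ 2 * hi
      · linear_combination hb + hx - w ^ 4 * g ^ 2 * hi + g ^ 2 * hw
      · linear_combination hc + hx
  obtain ⟨r₁, r₂, r₃, hB, hC, hX, hY⟩ := exists_half_parameters hs h hy
  -- The double `(r₁², r₁r₂r₃)` is 2-torsion. The vanishing factor tells which of (0, 0), (s, 0),
  -- (-s, 0) it is, with `s = g²`, and x is then ±is, s(1 ± √2) or s(-1 ± √2) respectively.
  have hprod : r₁ * r₂ * r₃ = 0 := by
    subst hX hY
    obtain ⟨h', hP⟩ := two_nsmul_some hs hB hC h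
    rwa [show (4 : ℕ) = 2 * 2 from rfl, mul_nsmul', hP, two_nsmul_eq_zero_iff] at h4
  rcases mul_eq_zero.1 hprod with hr | rfl
  · rcases mul_eq_zero.1 hr with rfl | rfl
    · have hx : (x - i * g ^ 2) * (x + i * g ^ 2) = 0 := by
        rw [hX]
        linear_combination r₃ ^ 2 * hB - g ^ 2 * hC - g ^ 4 * hi
      rcases mul_eq_zero.1 hx with hx | hx
      · refine ⟨mem (mul_mem hzF hgF) ?_,
          mem (mul_mem (mul_mem hiF hvF) hgF) ?_,
          mem (mul_mem huF hgF) ?_⟩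
        · linear_combination ha + hx - g ^ 2 * hz
        · linear_combination hb + hx - i ^ 2 * g ^ 2 * hv - g ^ 2 * (1 - i) * hi
        · linear_combination hc + hx - g ^ 2 * hu
      · refine ⟨mem (mul_mem (mul_mem hiF hzF) hgF) ?_,
          mem (mul_mem (mul_mem hiF huF) hgF) ?_,
          mem (mul_mem hvF hgF) ?_⟩
        · linear_combination ha + hx - i ^ 2 * g ^ 2 * hz - i * g ^ 2 * hi
        · linear_combination hb + hx - i ^ 2 * g ^ 2 * hu - g ^ 2 * (1 + i) * hi
        · linear_combination hc + hx - g ^ 2 * hv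
    · have hx : (x - g ^ 2 - w ^ 2 * g ^ 2) * (x - g ^ 2 + w ^ 2 * g ^ 2) = 0 := by
        rw [hX]
        linear_combination r₁ ^ 2 * hC -
          (r₁ ^ 2 + 2 * g ^ 2 + (r₁ ^ 2 - g ^ 2) + 2 * r₁ * r₃) * hB - g ^ 4 * hw
      rcases mul_eq_zero.1 hx with hx | hx
      · refine ⟨mem (mul_mem hgF hpF) ?_,
          mem (mul_mem hwF hgF) ?_,
          mem (mul_mem (mul_mem hwF hgF) hpF) ?_⟩
        · linear_combination ha + hx - g ^ 2 * hp
        · linear_combination hb + hx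
        · linear_combination hc + hx - w ^ 2 * g ^ 2 * hp - g ^ 2 * hw
      · refine ⟨mem (mul_mem (mul_mem hiF hgF) hmF) ?_,
          mem (mul_mem (mul_mem hiF hwF) hgF) ?_,
          mem (mul_mem (mul_mem hwF hgF) hmF) ?_⟩
        · linear_combination ha + hx - i ^ 2 * g ^ 2 * hm - g ^ 2 * (w ^ 2 - 1) * hi
        · linear_combination hb + hx - w ^ 2 * g ^ 2 * hi
        · linear_combination hc + hx - w ^ 2 * g ^ 2 * hm - g ^ 2 * hw
  · have hx : (x + g ^ 2 - w ^ 2 * g ^ 2) * (x + g ^ 2 + w ^ 2 * g ^ 2) = 0 := by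
      rw [hX]
      linear_combination r₁ ^ 2 * hB -
        (r₁ ^ 2 - 2 * g ^ 2 + (r₁ ^ 2 + g ^ 2) + 2 * r₁ * r₂) * hC - g ^ 4 * hw
    rcases mul_eq_zero.1 hx with hx | hx
    · refine ⟨mem (mul_mem hgF hmF) ?_,
        mem (mul_mem (mul_mem hiF hwF) (mul_mem hgF hmF)) ?_,
        mem (mul_mem hwF hgF) ?_⟩
      · linear_combination ha + hx - g ^ 2 * hm
      · linear_combination hb + hx - i ^ 2 * w ^ 2 * g ^ 2 * hm - w ^ 2 * g ^ 2 * (w ^ 2 - 1) * hi +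
          g ^ 2 * hw
      · linear_combination hc + hx
    · refine ⟨mem (mul_mem (mul_mem hiF hgF) hpF) ?_,
        mem (mul_mem (mul_mem hiF hwF) (mul_mem hgF hpF)) ?_,
        mem (mul_mem (mul_mem hiF hwF) hgF) ?_⟩
      · linear_combination ha + hx - i ^ 2 * g ^ 2 * hp - g ^ 2 * (1 + w ^ 2) * hi
      · linear_combination hb + hx - i ^ 2 * w ^ 2 * g ^ 2 * hp - w ^ 2 * g ^ 2 * (1 + w ^ 2) * hi +
          g ^ 2 * hw
      · linear_combination hc + hx - w ^ 2 * g ^ 2 * hi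

open scoped Classical in
-- A point with `y ≠ 0` is a polynomial in its half parameters, which are the square roots attached
-- to its double, a point killed by 4.
theorem mem_of_eight_nsmul_eq_zero (hi : i ^ 2 = -1) (hw : w ^ 4 = 2) (hu : u ^ 2 = 1 + i)
    {g : Ω} (hg : g ≠ 0) {F : IntermediateField k Ω} (hiF : i ∈ F) (hwF : w ∈ F) (huF : u ∈ F)
    (hgF : g ∈ F) {x y : Ω} (h : (splitCurve (g ^ 2)).Nonsingular x y)
    (h8 : 8 • some x y h = 0) : x ∈ F ∧ y ∈ F := by
  have hs : g ^ 2 ≠ 0 := pow_ne_zero 2 hg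
  by_cases hy : y = 0
  · subst hy
    have hg2 := pow_mem hgF 2
    have hx : x * ((x - g ^ 2) * (x + g ^ 2)) = 0 := by
      linear_combination -(nonsingular_iff hs).1 h
    refine ⟨?_, F.zero_mem⟩
    rcases mul_eq_zero.1 hx with rfl | hx
    · exact F.zero_mem
    rcases mul_eq_zero.1 hx with hx | hx
    · rwa [sub_eq_zero.1 hx]
    · rw [eq_neg_of_add_eq_zero_left hx]
      exact F.neg_mem hg2
  obtain ⟨a, b, c, hb, hc, rfl, rfl⟩ := exists_half_parameters hs h hy
  obtain ⟨h', hP⟩ := two_nsmul_some hs hb hc h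
  rw [show (8 : ℕ) = 4 * 2 from rfl, mul_nsmul', hP] at h8
  obtain ⟨haF, hbF, hcF⟩ :=
    sqrt_mem_of_four_nsmul_eq_zero hi hw hu hg hiF hwF huF hgF h' h8 rfl hb hc
  have hxF := F.mul_mem (F.add_mem haF hbF) (F.add_mem haF hcF)
  exact ⟨hxF, F.mul_mem hxF (F.add_mem hbF hcF)⟩

end splitCurve

/-! ### The 8-division field of E^d and its degree. -/

theorem baseChange_curveE {Ω : Type*} [Field Ω] [Algebra ℚ Ω] {d : ℤ} {s : Ω} (hs : s ^ 2 = -d) :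
    ((curveE d).baseChange Ω).toAffine = splitCurve s := by
  ext <;> simp [curveE, splitCurve, WeierstrassCurve.baseChange, hs]

open scoped Classical in
theorem adjoin_eight_torsion_curveE {Ω : Type*} [Field Ω] [Algebra ℚ Ω] [CharZero Ω]
    {i w u δ : Ω} (hi : i ^ 2 = -1) (hw : w ^ 4 = 2) (hu : u ^ 2 = 1 + i) {d : ℤ} (hd : d ≠ 0)
    (hδ : δ ^ 4 = d) :
    adjoin ℚ {z : Ω | ∃ (x y : Ω) (h : ((curveE d).baseChange Ω).toAffine.Nonsingular x y),
      8 • WeierstrassCurve.Affine.Point.some x y h = 0 ∧ (z = x ∨ z = y)} =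
    towerField i w u ⊔ ℚ⟮δ ^ 2⟯ ⊔ ℚ⟮δ⟯ := by
  have hδ0 : δ ≠ 0 := by
    rintro rfl
    apply hd
    have : (d : Ω) = 0 := by rw [← hδ]; simp
    exact_mod_cast this
  have hw0 : w ≠ 0 := by
    rintro rfl
    exact two_ne_zero (α := Ω) (by rw [← hw]; simp)
  have hi0 : i ≠ 0 := by
    rintro rfl
    simp at hi
  have hs : (i * δ ^ 2) ^ 2 = -(d : Ω) := by
    rw [← hδ]
    linear_combination δ ^ 4 * hi
  rw [baseChange_curveE hs]
  apply le_antisymm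
  · set L := towerField i w u ⊔ ℚ⟮δ ^ 2⟯ ⊔ ℚ⟮δ⟯
    have hle : towerField i w u ≤ L := le_sup_left.trans le_sup_left
    obtain ⟨hiL, hwL, huL⟩ := towerField_le_iff.1 hle
    have hδL : δ ∈ L := (le_sup_right : ℚ⟮δ⟯ ≤ L) (mem_adjoin_simple_self ℚ δ)
    have hz := sq_one_add_div_sq hi hw
    have hzL := one_add_div_sq_mem hiL (pow_mem hwL 2)
    have hz0 : (1 + i) / w ^ 2 ≠ 0 := by
      intro h0
      rw [h0] at hz
      exact hi0 (by rw [← hz]; simp)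
    rw [adjoin_le_iff]
    rintro z ⟨x, y, h, h8, hzxy⟩
    -- The eighth root of unity supplies the square root of s inside K(δ).
    have hg : ((1 + i) / w ^ 2 * δ) ^ 2 = i * δ ^ 2 := by rw [mul_pow, hz]
    have hmem : x ∈ L ∧ y ∈ L := by
      generalize i * δ ^ 2 = s at h hg h8
      subst hg
      exact splitCurve.mem_of_eight_nsmul_eq_zero hi hw hu (mul_ne_zero hz0 hδ0) hiL hwL huL
        (mul_mem hzL hδL) h h8
    rcases hzxy with rfl | rfl
    exacts [hmem.1, hmem.2]
  · set L := adjoin ℚ {z : Ω | ∃ (x y : Ω) (h : (splitCurve (i * δ ^ 2)).Nonsingular x y),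
      8 • WeierstrassCurve.Affine.Point.some x y h = 0 ∧ (z = x ∨ z = y)}
    obtain ⟨h1, h2, h3, h4⟩ := splitCurve.mem_of_eight_torsion_subset (F := L) hi hw hu hδ0
      (fun x y h h8 => ⟨subset_adjoin ℚ _ ⟨x, y, h, h8, Or.inl rfl⟩,
        subset_adjoin ℚ _ ⟨x, y, h, h8, Or.inr rfl⟩⟩)
    exact sup_le (sup_le (towerField_le_iff.2 ⟨h1, h2, h3⟩) (adjoin_simple_le_iff.2 (pow_mem h4 2)))
      (adjoin_simple_le_iff.2 h4)

open scoped Classical in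
/-- The degree of the field of `8`-torsion of `curveE d` inside any algebraic closure of `ℚ`. -/
theorem finrank_adjoin_eight_torsion_curveE {Ω : Type*} [Field Ω] [Algebra ℚ Ω] [CharZero Ω]
    [Algebra.IsAlgebraic ℚ Ω] [IsAlgClosed Ω] (d : ℤ) (hd0 : d ≠ 0) (hd : FourthPowerFree d)
    (K : IntermediateField ℚ Ω)
    (hK : K = adjoin ℚ {z : Ω | ∃ (x y : Ω)
      (h : ((curveE d).baseChange Ω).toAffine.Nonsingular x y),
        8 • WeierstrassCurve.Affine.Point.some x y h = 0 ∧ (z = x ∨ z = y)}) :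
    (Module.finrank ℚ K = 16 ↔
      d ∈ ({1, -1, 2, -2, 4, -4, 8, -8} : Set ℤ)) ∧
    (Module.finrank ℚ K = 32 ↔
      ∃ t : ℤ, Squarefree t ∧ t ∉ ({1, -1, 2, -2} : Set ℤ) ∧
        (d = t ^ 2 ∨ d = -t ^ 2 ∨ d = 2 * t ^ 2 ∨ d = -(2 * t ^ 2))) ∧
    (d ∉ ({1, -1, 2, -2, 4, -4, 8, -8} : Set ℤ) →
      (¬ ∃ t : ℤ, Squarefree t ∧ t ∉ ({1, -1, 2, -2} : Set ℤ) ∧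
        (d = t ^ 2 ∨ d = -t ^ 2 ∨ d = 2 * t ^ 2 ∨ d = -(2 * t ^ 2))) →
      Module.finrank ℚ K = 64) := by
  obtain ⟨i, hi⟩ := IsAlgClosed.exists_pow_nat_eq (-1 : Ω) (n := 2) (by norm_num)
  obtain ⟨w, hw⟩ := IsAlgClosed.exists_pow_nat_eq (2 : Ω) (n := 4) (by norm_num)
  obtain ⟨u, hu⟩ := IsAlgClosed.exists_pow_nat_eq (1 + i) (n := 2) (by norm_num)
  obtain ⟨δ, hδ⟩ := IsAlgClosed.exists_pow_nat_eq (d : Ω) (n := 4) (by norm_num)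
  rw [exists_squarefree_iff hd, ← sq_mem_towerField_iff hi hw hu hd0 hδ,
    ← mem_towerField_iff hi hw hu hd0 hd hδ, hK, adjoin_eight_torsion_curveE hi hw hu hd0 hδ]
  by_cases h1 : δ ∈ towerField i w u
  · simp [finrank_towerField_sup_of_mem hi hw hu h1, h1]
  by_cases h2 : δ ^ 2 ∈ towerField i w u
  · simp [finrank_towerField_sup_of_sq_mem hi hw hu h1 h2, h1, h2]
  · simp [finrank_towerField_sup_of_sq_notMem hi hw hu hδ h2, h1, h2]

theorem mainTheorem12 (d : ℤ) (hd0 : d ≠ 0) (hd : FourthPowerFree d) :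
    (Module.finrank ℚ (divisionField (curveE d) 8) = 16 ↔
      d ∈ ({1, -1, 2, -2, 4, -4, 8, -8} : Set ℤ)) ∧
    (Module.finrank ℚ (divisionField (curveE d) 8) = 32 ↔
      ∃ t : ℤ, Squarefree t ∧ t ∉ ({1, -1, 2, -2} : Set ℤ) ∧
        (d = t ^ 2 ∨ d = -t ^ 2 ∨ d = 2 * t ^ 2 ∨ d = -(2 * t ^ 2))) ∧
    (d ∉ ({1, -1, 2, -2, 4, -4, 8, -8} : Set ℤ) →
      (¬ ∃ t : ℤ, Squarefree t ∧ t ∉ ({1, -1, 2, -2} : Set ℤ) ∧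
        (d = t ^ 2 ∨ d = -t ^ 2 ∨ d = 2 * t ^ 2 ∨ d = -(2 * t ^ 2))) →
      Module.finrank ℚ (divisionField (curveE d) 8) = 64) := by
  have hchar : CharZero (AlgebraicClosure ℚ) := inferInstance
  exact @finrank_adjoin_eight_torsion_curveE (AlgebraicClosure ℚ) _ (AlgebraicClosure.instAlgebra ℚ)
    hchar (AlgebraicClosure.isAlgebraic ℚ) _ d hd0 hd (divisionField (curveE d) 8) rfl
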